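/- Let $k$ be a field of characteristic different from $2$. A *weighted arithmetic circuit* over $k$ is a finite directed acyclic multigraph whose vertices (gates) have in-degree $0$ or $2$, with exactly one gate of out-degree $0$ (the output), and with a weight in $k$ on each arrow. Gates of in-degree $0$ (inputs) are labelled by a constant of $k$ or by a variable; gates of in-degree $2$ (computation gates) are labelled by $+$ or $\times$, and the gates from which their two incoming arrows start (possibly twice the same gate) are called their arguments. An input computes its label; a computation gate whose incoming arrows have weights $c_1,c_2$ and start at gates computing $f_1,f_2$ computes $c_1f_1+c_2f_2$ or $(c_1f_1)(c_2f_2)$, according to its label. The circuit computes the polynomial computed by its output. The *sub-circuit* of a gate $\beta$ consists of all the gates from which there is a directed path to $\beta$, including $\beta$. The circuit is *weakly skew* if every multiplication gate $\alpha$ has an argument $\beta$ whose sub-circuit is connected to the rest of the circuit only by a single arrow, going from $\beta$ to $\alpha$. Call a gate *constant* if its sub-circuit contains no input labelled by a variable. The *green size* of the circuit is the number of computation gates that are not constant and are not multiplication gates with a constant argument (so variable-free sub-circuits and multiplications by constants are free). **Theorem.** Let $f$ be a polynomial computed by a weighted weakly skew circuit over $k$ of green size $e$ with $i$ input gates labelled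 by a variable. Then there are an integer $n$ with $1\le n\le 2(e+i)+1$ and a symmetric $n\times n$ matrix $A$ such that $f=\det A$ and every entry of $A$ is either a variable labelling an input gate of the circuit or an element of the subring of $k$ generated by $\tfrac12$, the labels of the constant inputs and the weights of the arrows. -/

import Mathlib

/-- The two kinds of computation gates. -/
inductive ArithOp where
  | add
  | mul

/-- The description of a gate: an input labelled by a constant of `k` or by a variable of `σ`, or a
computation gate (in-degree `2`). For a computation gate, `arg p` is the gate from which the `p`-th
incoming arrow starts and `weight p` is the weight of that arrow. The two arguments may coincide. -/
inductive CircuitNode (k σ G : Type*) where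
  | const (c : k)
  | var (x : σ)
  | op (o : ArithOp) (arg : Fin 2 → G) (weight : Fin 2 → k)

/-- The `p`-th arrow coming to the gate `h` starts from the gate `g`. -/
def CircuitNode.IsArrow {k σ G : Type*} (node : G → CircuitNode k σ G) (g h : G) (p : Fin 2) :
    Prop :=
  ∃ o arg weight, node h = .op o arg weight ∧ arg p = g

/-- A weighted arithmetic circuit with set of gates `G` (finite in all uses), constants and arrow
weights in `k`, and variables in `σ`. -/
structure WeightedCircuit (k σ G : Type*) where
  node : G → CircuitNode k σ G
  /-- The digraph has no directed cycle (for a finite set of gates, this is well-foundedness). -/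
  acyclic : WellFounded fun g h => ∃ p, CircuitNode.IsArrow node g h p
  output : G
  /-- The output is the unique gate of out-degree `0`. -/
  output_iff : ∀ g, (∀ h p, ¬ CircuitNode.IsArrow node g h p) ↔ g = output

namespace WeightedCircuit

variable {k σ G : Type*}

/-- The polynomial computed by a gate: along an arrow of weight `c` starting from a gate that
computes `f`, the value `c * f` is received. -/
noncomputable def gatePoly [CommSemiring k] (C : WeightedCircuit k σ G) :
    G → MvPolynomial σ k :=
  C.acyclic.fix fun h ih =>
    match hn : C.node h with
    | .const c => MvPolynomial.C c
    | .var x => MvPolynomial.X x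
    | .op .add a w =>
        MvPolynomial.C (w 0) * ih (a 0) ⟨0, _, a, w, hn, rfl⟩ +
          MvPolynomial.C (w 1) * ih (a 1) ⟨1, _, a, w, hn, rfl⟩
    | .op .mul a w =>
        (MvPolynomial.C (w 0) * ih (a 0) ⟨0, _, a, w, hn, rfl⟩) *
          (MvPolynomial.C (w 1) * ih (a 1) ⟨1, _, a, w, hn, rfl⟩)

/-- The recursion satisfied by the polynomials computed at the gates. -/
theorem gatePoly_eq [CommSemiring k] (C : WeightedCircuit k σ G) (h : G) :
    C.gatePoly h =
      match C.node h with
      | .const c => MvPolynomial.C c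
      | .var x => MvPolynomial.X x
      | .op .add a w =>
          MvPolynomial.C (w 0) * C.gatePoly (a 0) + MvPolynomial.C (w 1) * C.gatePoly (a 1)
      | .op .mul a w =>
          (MvPolynomial.C (w 0) * C.gatePoly (a 0)) *
            (MvPolynomial.C (w 1) * C.gatePoly (a 1)) := by
  rw [gatePoly, WellFounded.fix_eq]
  split <;> rename_i hn <;> simp only [hn]

/-- The polynomial computed by the circuit. -/
noncomputable def poly [CommSemiring k] (C : WeightedCircuit k σ G) : MvPolynomial σ k :=
  C.gatePoly C.output

/-- The gates of the sub-circuit associated to `g`: those from which there is an oriented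
(possibly empty) path to `g`. -/
def sub (C : WeightedCircuit k σ G) (g : G) : Set G :=
  {h | Relation.ReflTransGen (fun a b => ∃ p, CircuitNode.IsArrow C.node a b p) h g}

/-- Every multiplication gate `α` has an argument `arg p` whose sub-circuit is connected to the rest
of the circuit only by the arrow number `p` of `α`, which goes from `arg p` to `α`. (No arrow
enters a sub-circuit from outside, so only the arrows leaving it are considered.) -/
def IsWeaklySkew (C : WeightedCircuit k σ G) : Prop :=
  ∀ α arg weight, C.node α = .op .mul arg weight →
    ∃ p : Fin 2, ∀ g h q, CircuitNode.IsArrow C.node g h q →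
      g ∈ C.sub (arg p) → h ∉ C.sub (arg p) → h = α ∧ q = p

/-- The constant gates, i.e. the gates whose sub-circuit is free of variables: the constant inputs
and, recursively, the computation gates both of whose arguments are constant. In a minimized
circuit all of them have been turned into inputs. -/
inductive IsConstGate (C : WeightedCircuit k σ G) : G → Prop
  | input {g : G} (c : k) (hg : C.node g = .const c) : IsConstGate C g
  | op {g : G} (o : ArithOp) (arg : Fin 2 → G) (weight : Fin 2 → k)
      (hg : C.node g = .op o arg weight) (h : ∀ p, IsConstGate C (arg p)) : IsConstGate C g

/-- The multiplication gates one of whose arguments is constant. In a minimized circuit they have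
been deleted, the constant factor being moved to weights. -/
def IsMulByConst (C : WeightedCircuit k σ G) (g : G) : Prop :=
  ∃ arg weight, C.node g = .op .mul arg weight ∧ ∃ p, C.IsConstGate (arg p)

/-- The computation gates that remain in the minimized circuit. -/
def greenGates (C : WeightedCircuit k σ G) : Set G :=
  {g | (∃ o arg weight, C.node g = .op o arg weight) ∧ ¬ C.IsConstGate g ∧ ¬ C.IsMulByConst g}

/-- The green size: the number of computation gates of the minimized circuit. -/
noncomputable def greenSize (C : WeightedCircuit k σ G) : ℕ :=
  C.greenGates.ncard

/-- The number of input gates labelled by a variable. -/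
noncomputable def numVarInputs (C : WeightedCircuit k σ G) : ℕ :=
  {g | ∃ x, C.node g = .var x}.ncard

/-- The scalars occurring in the circuit: the labels of the constant inputs and the weights of the
arrows. -/
def scalars (C : WeightedCircuit k σ G) : Set k :=
  {c | (∃ g, C.node g = .const c) ∨ ∃ g o arg weight p, C.node g = .op o arg weight ∧ weight p = c}

end WeightedCircuit

/-! A product of two circuit values is not a program instruction, but every instruction is
homogeneous: started from `y` instead of `1`, a program multiplies all its values by `y`
(`IsProgram.map_mul_append`). At a multiplication gate, weak skewness isolates the sub-circuit of
one argument, so it can be run from the value of the other and the gate itself costs nothing.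
Keeping values only up to a scalar of `K` makes constants free too, so at most `e + i` instructions
suffice (`IsWeaklySkew.exists_isProgram`).

The `m` values of a program solve a linear system `M y = -p` with `det M = ±1`. Bordering the
symmetric block matrix made of `M` and `Mᵀ` gives a symmetric matrix of size `2m + 1` whose
determinant reads off twice a linear form in the values (`det_symmetricBorder`). Dividing by 2 is
where the characteristic enters. -/

open MvPolynomial Matrix

/-- The admissible matrix entries: variables from `V` and constants from the subring `K`. -/
def entrySet {k σ : Type*} [Field k] (K : Subring k) (V : Set σ) : Set (MvPolynomial σ k) :=
  {e | (∃ x ∈ V, e = X x) ∨ ∃ c ∈ K, e = MvPolynomial.C c}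

/-- Straight-line programs given by the list of their values (the latest first, the value `1` being
implicit): each instruction is a linear combination of two earlier values with scalars in `K`, or
the product of an earlier value by a variable from `V`. -/
inductive IsProgram {k σ : Type*} [Field k] (K : Subring k) (V : Set σ) :
    List (MvPolynomial σ k) → Prop
  | nil : IsProgram K V []
  | add {l : List (MvPolynomial σ k)} (a b : k) (z w : MvPolynomial σ k) (ha : a ∈ K) (hb : b ∈ K)
      (hz : z ∈ 1 :: l) (hw : w ∈ 1 :: l) (hl : IsProgram K V l) :
      IsProgram K V ((MvPolynomial.C a * z + MvPolynomial.C b * w) :: l)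
  | var {l : List (MvPolynomial σ k)} (x : σ) (z : MvPolynomial σ k) (hx : x ∈ V) (hz : z ∈ 1 :: l)
      (hl : IsProgram K V l) : IsProgram K V ((X x * z) :: l)

/-! ### Programs and triangular linear systems -/

section Program

variable {k σ : Type*} [Field k] {K : Subring k} {V : Set σ}

theorem C_mem_entrySet {c : k} (hc : c ∈ K) : MvPolynomial.C c ∈ entrySet K V :=
  Or.inr ⟨c, hc, rfl⟩

theorem zero_mem_entrySet : (0 : MvPolynomial σ k) ∈ entrySet K V :=
  Or.inr ⟨0, K.zero_mem, by simp⟩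

theorem mem_cons_map_mul_append {R : Type*} [MulOneClass R] {l₁ l₂ : List R} {y z : R}
    (hy : y ∈ 1 :: l₂) (hz : z ∈ 1 :: l₁) : z * y ∈ 1 :: (l₁.map (· * y) ++ l₂) := by
  rcases List.mem_cons.1 hz with rfl | hz
  · rw [one_mul]
    rcases List.mem_cons.1 hy with rfl | hy
    · exact List.mem_cons_self
    · exact List.mem_cons_of_mem _ (List.mem_append_right _ hy)
  · exact List.mem_cons_of_mem _ (List.mem_append_left _ (List.mem_map_of_mem hz))

/-- Running a program from the value `y` of another program instead of `1`. -/
theorem IsProgram.map_mul_append {l₁ l₂ : List (MvPolynomial σ k)} (h₁ : IsProgram K V l₁)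
    (h₂ : IsProgram K V l₂) {y : MvPolynomial σ k} (hy : y ∈ 1 :: l₂) :
    IsProgram K V (l₁.map (· * y) ++ l₂) := by
  induction h₁ with
  | nil => simpa using h₂
  | add a b z w ha hb hz hw _ ih =>
    have := IsProgram.add a b _ _ ha hb (mem_cons_map_mul_append hy hz)
      (mem_cons_map_mul_append hy hw) ih
    simpa [add_mul, mul_assoc] using this
  | var x z hx hz _ ih =>
    have := IsProgram.var x _ hx (mem_cons_map_mul_append hy hz) ih
    simpa [mul_assoc] using this

/-- `y` is an affine combination of the members of `l` with coefficients in `E`. -/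
def IsAffineComb (E : Set (MvPolynomial σ k)) (l : List (MvPolynomial σ k))
    (y : MvPolynomial σ k) : Prop :=
  ∃ (r : Fin l.length → MvPolynomial σ k) (t : MvPolynomial σ k),
    (∀ j, r j ∈ E) ∧ t ∈ E ∧ y = r ⬝ᵥ l.get + t

theorem isAffineComb_mul {E : Set (MvPolynomial σ k)} (h0 : 0 ∈ E) {e z : MvPolynomial σ k}
    (he : e ∈ E) {l : List (MvPolynomial σ k)} (hz : z ∈ 1 :: l) : IsAffineComb E l (e * z) := by
  rcases List.mem_cons.1 hz with rfl | hz
  · exact ⟨0, e, fun _ => h0, he, by simp⟩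
  · obtain ⟨j, rfl⟩ := List.get_of_mem hz
    refine ⟨Pi.single j e, 0, fun i => ?_, h0, by simp⟩
    rcases eq_or_ne i j with rfl | hij
    · simpa using he
    · simpa [Pi.single_eq_of_ne hij] using h0

/-- The two coefficient vectors may overlap and `entrySet` is not closed under addition, so both are
first taken among the constants. -/
theorem isAffineComb_C_add {l : List (MvPolynomial σ k)} {a b : k} {z w : MvPolynomial σ k}
    (ha : a ∈ K) (hb : b ∈ K) (hz : z ∈ 1 :: l) (hw : w ∈ 1 :: l) :
    IsAffineComb (entrySet K V) l (MvPolynomial.C a * z + MvPolynomial.C b * w) := by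
  have h0 : (0 : MvPolynomial σ k) ∈ MvPolynomial.C '' (K : Set k) := ⟨0, K.zero_mem, by simp⟩
  obtain ⟨r, t, hr, ⟨t', ht', rfl⟩, h₁⟩ := isAffineComb_mul h0 ⟨a, ha, rfl⟩ hz
  obtain ⟨s, u, hs, ⟨u', hu', rfl⟩, h₂⟩ := isAffineComb_mul h0 ⟨b, hb, rfl⟩ hw
  refine ⟨r + s, MvPolynomial.C (t' + u'), fun j => ?_, C_mem_entrySet (K.add_mem ht' hu'), ?_⟩
  · obtain ⟨c, hc, hc'⟩ := hr j
    obtain ⟨d, hd, hd'⟩ := hs j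
    exact Or.inr ⟨c + d, K.add_mem hc hd, by simp [← hc', ← hd']⟩
  · rw [h₁, h₂, add_dotProduct, map_add]
    ring

/-- The values of a program solve a linear system with admissible coefficients whose determinant
is `±1`. -/
theorem IsProgram.exists_matrix {l : List (MvPolynomial σ k)} (hl : IsProgram K V l) :
    ∃ (M : Matrix (Fin l.length) (Fin l.length) (MvPolynomial σ k))
      (p : Fin l.length → MvPolynomial σ k),
      (∀ i j, M i j ∈ entrySet K V) ∧ (∀ i, p i ∈ entrySet K V) ∧
        M.det = (-1) ^ l.length ∧ M *ᵥ l.get = -p := by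
  have step : ∀ {l : List (MvPolynomial σ k)} {y : MvPolynomial σ k},
      IsAffineComb (entrySet K V) l y →
      (∃ (M : Matrix (Fin l.length) (Fin l.length) (MvPolynomial σ k))
        (p : Fin l.length → MvPolynomial σ k),
        (∀ i j, M i j ∈ entrySet K V) ∧ (∀ i, p i ∈ entrySet K V) ∧
          M.det = (-1) ^ l.length ∧ M *ᵥ l.get = -p) →
      ∃ (M : Matrix (Fin (l.length + 1)) (Fin (l.length + 1)) (MvPolynomial σ k))
        (p : Fin (l.length + 1) → MvPolynomial σ k),
        (∀ i j, M i j ∈ entrySet K V) ∧ (∀ i, p i ∈ entrySet K V) ∧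
          M.det = (-1) ^ (l.length + 1) ∧ M *ᵥ (y :: l).get = -p := by
    rintro l y ⟨r, t, hr, ht, hy⟩ ⟨M, p, hM, hp, hdet, hMp⟩
    -- The new row encodes `-y + r ⬝ᵥ l.get = -t`. As the latest value comes first, the matrix is
    -- upper triangular with diagonal `-1`.
    refine ⟨Matrix.of (Fin.cons (Fin.cons (-1) r) fun i => Fin.cons 0 (M i)), Fin.cons t p,
      ?_, ?_, ?_, ?_⟩
    · intro i j
      refine Fin.cases ?_ (fun i => ?_) i <;> refine Fin.cases ?_ (fun j => ?_) j
      · exact Or.inr ⟨-1, K.neg_mem K.one_mem, by simp⟩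
      · simpa using hr j
      · simpa using zero_mem_entrySet
      · simpa using hM i j
    · intro i
      refine Fin.cases ?_ (fun i => ?_) i
      · simpa using ht
      · simpa using hp i
    · have hsub : (Matrix.of (Fin.cons (Fin.cons (-1) r) fun i => Fin.cons 0 (M i)) :
          Matrix (Fin (l.length + 1)) (Fin (l.length + 1)) (MvPolynomial σ k)).submatrix
            Fin.succ Fin.succ = M := by
        ext i j
        simp
      rw [det_succ_column_zero, Fin.sum_univ_succ]
      simp [hsub, hdet, pow_succ]
    · funext i
      refine Fin.cases ?_ (fun i => ?_) i
      · simp only [mulVec, dotProduct, Fin.sum_univ_succ]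
        simp only [dotProduct, List.get_eq_getElem] at hy
        simp [hy]
      · have := congrFun hMp i
        simp only [mulVec, dotProduct, List.get_eq_getElem, Pi.neg_apply] at this
        simp only [mulVec, dotProduct, Fin.sum_univ_succ]
        simpa using this
  induction hl with
  | nil => exact ⟨0, 0, fun i => i.elim0, fun i => i.elim0, by simp, funext fun i => i.elim0⟩
  | add a b z w ha hb hz hw _ ih => exact step (isAffineComb_C_add ha hb hz hw) ih
  | var x z hx hz _ ih =>
    exact step (isAffineComb_mul zero_mem_entrySet (Or.inl ⟨x, hx, rfl⟩) hz) ih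

end Program

/-! ### Determinant of the symmetric bordered matrix -/

section BorderedDeterminant

variable {R ι : Type*} [CommRing R]

/-- The symmetric matrix with blocks `0`, `M`, `Mᵀ`, `0` bordered by the vectors `u`, `v` and the
corner `c`. -/
def symmetricBorder (M : Matrix ι ι R) (u v : ι → R) (c : R) :
    Matrix ((ι ⊕ ι) ⊕ Unit) ((ι ⊕ ι) ⊕ Unit) R :=
  fromBlocks (fromBlocks 0 M Mᵀ 0) (replicateCol Unit (Sum.elim u v))
    (replicateRow Unit (Sum.elim u v)) (Matrix.of fun _ _ => c)

theorem symmetricBorder_isSymm (M : Matrix ι ι R) (u v : ι → R) (c : R) :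
    (symmetricBorder M u v c).IsSymm := by
  refine IsSymm.fromBlocks ?_ (by simp) (by ext; rfl)
  refine IsSymm.fromBlocks (by simp) rfl (by simp)

variable [Fintype ι] [DecidableEq ι]

theorem det_fromBlocks_zero_transpose (M : Matrix ι ι R) :
    (fromBlocks 0 M Mᵀ 0).det = (-1) ^ Fintype.card ι * M.det ^ 2 := by
  have hJ : (fromBlocks 0 1 1 0 : Matrix (ι ⊕ ι) (ι ⊕ ι) R).det = (-1) ^ Fintype.card ι := by
    have h : (fromBlocks 0 1 1 0 : Matrix (ι ⊕ ι) (ι ⊕ ι) R) * fromBlocks 1 0 1 1 =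
        fromBlocks 1 1 1 0 := by
      simp [fromBlocks_multiply]
    have h' := congrArg det h
    rw [det_mul, det_fromBlocks_zero₁₂, det_fromBlocks_one₁₁] at h'
    simpa [det_neg] using h'
  have h : fromBlocks 0 M Mᵀ 0 = fromBlocks M 0 0 Mᵀ * fromBlocks 0 1 1 0 := by
    simp [fromBlocks_multiply]
  rw [h, det_mul, hJ, det_fromBlocks_zero₁₂, det_transpose]
  ring

/-- A unipotent column operation by the solutions `z`, `y` of `Mᵀ z = -v`, `M y = -u` clears the
border column. The corner becomes `c + u ⬝ᵥ z + v ⬝ᵥ y`, and the two products agree by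
transposition. -/
theorem det_symmetricBorder {M : Matrix ι ι R} (hM : IsUnit M.det) {u v y : ι → R}
    (hy : M *ᵥ y = -u) (c : R) :
    (symmetricBorder M u v c).det =
      (-1) ^ Fintype.card ι * M.det ^ 2 * (c + 2 * (v ⬝ᵥ y)) := by
  obtain ⟨z, hMz⟩ : ∃ z, Mᵀ *ᵥ z = -v := ⟨-(Mᵀ⁻¹ *ᵥ v), by
    rw [mulVec_neg, mulVec_mulVec, mul_nonsing_inv _ (by rwa [det_transpose]), one_mulVec]⟩
  have huz : u ⬝ᵥ z = v ⬝ᵥ y := by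
    have h : (M *ᵥ y) ⬝ᵥ z = y ⬝ᵥ (Mᵀ *ᵥ z) := by
      rw [mulVec_transpose, dotProduct_comm, dotProduct_mulVec, dotProduct_comm]
    rw [hy, hMz, neg_dotProduct, dotProduct_neg] at h
    exact (neg_injective h).trans (dotProduct_comm _ _)
  have hmul : symmetricBorder M u v c *
      fromBlocks 1 (replicateCol Unit (Sum.elim z y)) 0 1 =
      fromBlocks (fromBlocks 0 M Mᵀ 0) 0 (replicateRow Unit (Sum.elim u v))
        (Matrix.of fun _ _ => c + 2 * (v ⬝ᵥ y)) := by
    rw [symmetricBorder, fromBlocks_multiply]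
    congr 1
    · simp
    · ext i j
      rw [Matrix.mul_one, Matrix.add_apply, ← replicateCol_mulVec, replicateCol_apply,
        replicateCol_apply, fromBlocks_mulVec]
      rcases i with i | i
      · simp [hy]
      · simp [hMz]
    · simp
    · ext i j
      have : (replicateRow Unit (Sum.elim u v) * replicateCol Unit (Sum.elim z y)) i j =
          u ⬝ᵥ z + v ⬝ᵥ y := by
        simp [Matrix.mul_apply, dotProduct]
      rw [Matrix.mul_one, Matrix.add_apply, this, huz, Matrix.of_apply, Matrix.of_apply]
      ring
  have h := congrArg det hmul
  rw [det_mul, det_fromBlocks_zero₂₁, det_fromBlocks_zero₁₂, det_fromBlocks_zero_transpose] at h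
  simpa using h

end BorderedDeterminant

/-- Any scalar multiple of a value of a program with `m` instructions is the determinant of a
symmetric matrix of size `2 * m + 1` with admissible entries. -/
theorem IsProgram.exists_isSymm_det {k σ : Type*} [Field k] {K : Subring k} {V : Set σ}
    (h2 : (2 : k) ≠ 0) (hK : (1 / 2 : k) ∈ K) {l : List (MvPolynomial σ k)}
    (hl : IsProgram K V l) {a : k} (ha : a ∈ K) {y : MvPolynomial σ k} (hy : y ∈ 1 :: l) :
    ∃ A : Matrix (Fin (2 * l.length + 1)) (Fin (2 * l.length + 1)) (MvPolynomial σ k),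
      A.IsSymm ∧ (∀ i j, A i j ∈ entrySet K V) ∧ MvPolynomial.C a * y = A.det := by
  obtain ⟨M, p, hM, hp, hdet, hMp⟩ := hl.exists_matrix
  have hs : (-1 : k) ^ l.length ∈ K := K.pow_mem (K.neg_mem K.one_mem) _
  -- The sign and the half cancel the factors `(-1) ^ l.length` and `2` of `det_symmetricBorder`.
  -- The constant term `t` of the affine form goes to the corner, as `2 * t`.
  have hhalf : (-1) ^ l.length * a * (1 / 2) ∈ K := K.mul_mem (K.mul_mem hs ha) hK
  have h0 : (0 : MvPolynomial σ k) ∈ MvPolynomial.C '' (K : Set k) := ⟨0, K.zero_mem, by simp⟩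
  obtain ⟨v, t, hv, ⟨t, ht, rfl⟩, hvy⟩ := isAffineComb_mul h0 ⟨_, hhalf, rfl⟩ hy
  have hcard : Fintype.card ((Fin l.length ⊕ Fin l.length) ⊕ Unit) = 2 * l.length + 1 := by
    simp [two_mul]
  let e := Fintype.equivFinOfCardEq hcard
  refine ⟨reindex e e (symmetricBorder M p v (MvPolynomial.C (2 * t))), ?_, ?_, ?_⟩
  · exact (symmetricBorder_isSymm M p v _).submatrix _
  · have hv' : ∀ i, v i ∈ entrySet K V := fun i => by
      obtain ⟨c, hc, hc'⟩ := hv i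
      exact Or.inr ⟨c, hc, hc'.symm⟩
    have h2t : MvPolynomial.C (2 * t) ∈ entrySet K V :=
      C_mem_entrySet (by simpa [two_mul] using K.add_mem ht ht)
    intro i j
    rw [reindex_apply, submatrix_apply]
    rcases e.symm i with (i | i) | i <;> rcases e.symm j with (j | j) | j <;>
      simp only [symmetricBorder, fromBlocks_apply₁₁, fromBlocks_apply₁₂, fromBlocks_apply₂₁,
        fromBlocks_apply₂₂, replicateCol_apply, replicateRow_apply, Sum.elim_inl, Sum.elim_inr,
        Matrix.zero_apply, transpose_apply, Matrix.of_apply, hM, hp, hv', h2t, zero_mem_entrySet]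
  · have hu : IsUnit M.det := by
      rw [hdet]
      exact (isUnit_one.neg).pow _
    have hC2 : (2 : MvPolynomial σ k) = MvPolynomial.C 2 := (map_ofNat _ 2).symm
    have hsq : ((-1 : MvPolynomial σ k) ^ l.length) ^ 2 = 1 := by
      rw [← pow_mul, mul_comm, pow_mul]
      simp
    have hhalf' : (2 : MvPolynomial σ k) * MvPolynomial.C (1 / 2) = 1 := by
      rw [hC2, ← map_mul, mul_one_div_cancel h2, map_one]
    rw [det_reindex_self, det_symmetricBorder hu hMp, hdet, Fintype.card_fin, hsq, map_mul, ← hC2,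
      ← mul_add, add_comm, ← hvy]
    simp only [map_mul, map_pow, map_neg, map_one]
    linear_combination (-(MvPolynomial.C a * y)) * (hsq +
      ((-1 : MvPolynomial σ k) ^ l.length) ^ 2 * hhalf')

namespace WeightedCircuit

open CircuitNode

/-! ### Sinks, closed arrows and reusable gates -/

section Structure

variable {k σ G : Type*} (C : WeightedCircuit k σ G)

/-- The arrow number `p` of `α`, starting from `b`, is the only one leaving the sub-circuit of
`b`. -/
def IsClosedArrow (b α : G) (p : Fin 2) : Prop :=
  IsArrow C.node b α p ∧
    ∀ g h q, IsArrow C.node g h q → g ∈ C.sub b → h ∉ C.sub b → h = α ∧ q = p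

/-- `g` belongs to no sub-circuit that is only used by one arrow going to a gate of `S`. -/
def IsReusableIn (S : Set G) (g : G) : Prop :=
  ∀ α ∈ S, ∀ b p, C.IsClosedArrow b α p → g ∉ C.sub b

/-- `S` is stable under taking arguments. -/
def IsArgClosed (S : Set G) : Prop :=
  ∀ g h p, IsArrow C.node g h p → h ∈ S → g ∈ S

/-- No arrow goes from `g` to a gate of `S`. -/
def IsSinkOf (S : Set G) (g : G) : Prop :=
  ∀ h p, IsArrow C.node g h p → h ∉ S

variable {C}

theorem mem_sub_self (g : G) : g ∈ C.sub g := Relation.ReflTransGen.refl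

theorem isArgClosed_sub (g : G) : C.IsArgClosed (C.sub g) := fun _ _ p ha hh =>
  Relation.ReflTransGen.head ⟨p, ha⟩ hh

theorem not_mem_sub_of_isArrow {b α : G} {p : Fin 2} (h : IsArrow C.node b α p) :
    α ∉ C.sub b := fun hα =>
  C.acyclic.transGen.irrefl.irrefl α (Relation.TransGen.tail' hα ⟨p, h⟩)

theorem ne_of_isArrow {b α : G} {p : Fin 2} (h : IsArrow C.node b α p) : b ≠ α := by
  rintro rfl
  exact not_mem_sub_of_isArrow h (mem_sub_self _)

theorem IsReusableIn.mono {S T : Set G} {g : G} (h : C.IsReusableIn S g) (hT : T ⊆ S) :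
    C.IsReusableIn T g := fun α hα => h α (hT hα)

theorem IsArgClosed.sub_subset {S : Set G} (hS : C.IsArgClosed S) {g : G} (hg : g ∈ S) :
    C.sub g ⊆ S := fun _ hh => by
  induction hh using Relation.ReflTransGen.head_induction_on with
  | refl => exact hg
  | head hab _ ih => exact hab.elim fun p hp => hS _ _ p hp ih

theorem IsSinkOf.not_mem_sub {S : Set G} (hS : C.IsArgClosed S) {g b α : G} {p : Fin 2}
    (hg : C.IsSinkOf S g) (hα : α ∈ S) (hb : IsArrow C.node b α p) : g ∉ C.sub b := by
  intro h
  rcases Relation.ReflTransGen.cases_head h with rfl | ⟨c, ⟨q, hq⟩, hc⟩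
  · exact hg _ _ hb hα
  · exact hg _ _ hq (hS.sub_subset (hS _ _ _ hb hα) hc)

/-- A closed sub-circuit containing `b` does not contain the sink `g`, so the arrow from `b` to `g`
leaves it and must be its unique exit. That exit would end in `T`, but `g ∉ T`. -/
theorem IsSinkOf.isReusableIn {S T : Set G} (hS : C.IsArgClosed S) {g b : G} {p : Fin 2}
    (hg : C.IsSinkOf S g) (hb : IsArrow C.node b g p) (hT : T ⊆ S) (hgT : g ∉ T) :
    C.IsReusableIn T b := fun _ hα _ _ hcl hmem =>
  hgT ((hcl.2 _ _ _ hb hmem (hg.not_mem_sub hS (hT hα) hcl.1)).1 ▸ hα)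

theorem isReusableIn_sub_self (b : G) : C.IsReusableIn (C.sub b) b := fun α hα b' _ hcl hb => by
  have h : Relation.ReflTransGen (fun a b => ∃ p, IsArrow C.node a b p) α b' :=
    Relation.ReflTransGen.trans hα hb
  exact not_mem_sub_of_isArrow hcl.1 h

theorem exists_isSinkOf [Finite G] {S : Set G} (hS : S.Nonempty) : ∃ g ∈ S, C.IsSinkOf S g := by
  let r : G → G → Prop := fun a b =>
    Relation.TransGen (fun a b => ∃ p, IsArrow C.node a b p) b a
  have : IsTrans G r := ⟨fun _ _ _ h₁ h₂ => h₂.trans h₁⟩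
  have : Std.Irrefl r := ⟨fun a => C.acyclic.transGen.irrefl.irrefl a⟩
  obtain ⟨g, hg, hmin⟩ := (Finite.wellFounded_of_trans_of_irrefl r).has_min S hS
  exact ⟨g, hg, fun h p hp hh => hmin h hh (Relation.TransGen.single ⟨p, hp⟩)⟩

theorem IsArgClosed.diff_singleton {S : Set G} (hS : C.IsArgClosed S) {g : G}
    (hg : C.IsSinkOf S g) : C.IsArgClosed (S \ {g}) := fun _ _ _ ha hh =>
  ⟨hS _ _ _ ha hh.1, by rintro rfl; exact hg _ _ ha hh.1⟩

/-- The only arrow leaving the removed sub-circuit ends at `g`, which is removed as well. -/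
theorem IsArgClosed.diff_sub {S : Set G} (hS : C.IsArgClosed S) {g b : G} {p : Fin 2}
    (hg : C.IsSinkOf S g) (hb : C.IsClosedArrow b g p) : C.IsArgClosed ((S \ {g}) \ C.sub b) :=
  fun _ _ q ha hh => ⟨hS.diff_singleton hg _ _ _ ha hh.1,
    fun hab => hh.1.2 (hb.2 _ _ q ha hab hh.2).1⟩

theorem isReusableIn_output (S : Set G) : C.IsReusableIn S C.output := fun α _ _ _ hcl h =>
  have hout : C.IsSinkOf Set.univ C.output := fun h p hp _ => (C.output_iff _).2 rfl h p hp
  hout.not_mem_sub (fun _ _ _ _ _ => trivial) (Set.mem_univ α) hcl.1 h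

theorem weight_mem_scalars {g : G} {o : ArithOp} {arg : Fin 2 → G} {w : Fin 2 → k}
    (hg : C.node g = .op o arg w) (p : Fin 2) : w p ∈ C.scalars :=
  Or.inr ⟨g, o, arg, w, p, hg, rfl⟩

end Structure

/-! ### From weakly skew circuits to programs -/

variable {k σ G : Type*} [Field k] {C : WeightedCircuit k σ G}

theorem gatePoly_of_mul {g : G} {arg : Fin 2 → G} {w : Fin 2 → k}
    (hg : C.node g = .op .mul arg w) {p q : Fin 2} (hpq : p ≠ q) :
    C.gatePoly g =
      MvPolynomial.C (w p * w q) * (C.gatePoly (arg p) * C.gatePoly (arg q)) := by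
  rw [gatePoly_eq, hg, map_mul]
  fin_cases p <;> fin_cases q <;> simp at hpq ⊢ <;> ring

theorem IsConstGate.gatePoly_eq_C {K : Subring k} (hK : C.scalars ⊆ K) {g : G}
    (hg : C.IsConstGate g) : ∃ c ∈ K, C.gatePoly g = MvPolynomial.C c := by
  induction hg with
  | @input g c hg => exact ⟨c, hK (Or.inl ⟨g, hg⟩), by rw [gatePoly_eq, hg]⟩
  | @op g o arg w hg _ ih =>
    obtain ⟨c, hc, hc'⟩ := ih 0
    obtain ⟨d, hd, hd'⟩ := ih 1
    have hw := fun p => hK (weight_mem_scalars hg p)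
    cases o with
    | add =>
      exact ⟨w 0 * c + w 1 * d, K.add_mem (K.mul_mem (hw 0) hc) (K.mul_mem (hw 1) hd), by
        rw [gatePoly_eq, hg]; simp [hc', hd']⟩
    | mul =>
      exact ⟨w 0 * c * (w 1 * d), K.mul_mem (K.mul_mem (hw 0) hc) (K.mul_mem (hw 1) hd), by
        rw [gatePoly_eq, hg]; simp [hc', hd']⟩

variable (C) in
/-- The gates paid for: the green gates and the inputs labelled by a variable. -/
def costGates : Set G :=
  C.greenGates ∪ {g | ∃ x, C.node g = .var x}

/-- `f` is, up to a scalar in `K`, the value `1` or a member of `l`. -/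
def IsScaledValue (K : Subring k) (l : List (MvPolynomial σ k)) (f : MvPolynomial σ k) : Prop :=
  ∃ a ∈ K, ∃ y ∈ 1 :: l, f = MvPolynomial.C a * y

theorem IsScaledValue.mono {K : Subring k} {l l' : List (MvPolynomial σ k)}
    {f : MvPolynomial σ k} (h : IsScaledValue K l f) (hl : l ⊆ l') : IsScaledValue K l' f := by
  obtain ⟨a, ha, y, hy, hf⟩ := h
  exact ⟨a, ha, y, List.cons_subset_cons 1 hl hy, hf⟩

theorem IsScaledValue.of_mem {K : Subring k} {l : List (MvPolynomial σ k)}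
    {f : MvPolynomial σ k} (h : f ∈ 1 :: l) : IsScaledValue K l f :=
  ⟨1, K.one_mem, f, h, by simp⟩

theorem IsScaledValue.C_mul {K : Subring k} {l : List (MvPolynomial σ k)}
    {f : MvPolynomial σ k} (h : IsScaledValue K l f) {c : k} (hc : c ∈ K) :
    IsScaledValue K l (MvPolynomial.C c * f) := by
  obtain ⟨a, ha, y, hy, rfl⟩ := h
  exact ⟨c * a, K.mul_mem hc ha, y, hy, by rw [map_mul, mul_assoc]⟩

/-- A set of gates stable under taking arguments is computed by a program with one instruction for
each green gate and each variable input. -/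
theorem IsWeaklySkew.exists_isProgram [Finite G] (hC : C.IsWeaklySkew) {K : Subring k}
    (hK : C.scalars ⊆ K) (S : Set G) (hS : C.IsArgClosed S) :
    ∃ l, IsProgram K {x | ∃ g, C.node g = .var x} l ∧ l.length ≤ (S ∩ C.costGates).ncard ∧
      ∀ g ∈ S, C.IsReusableIn S g → IsScaledValue K l (C.gatePoly g) := by
  induction S using WellFoundedLT.induction with
  | ind S ih =>
  rcases S.eq_empty_or_nonempty with rfl | hne
  · exact ⟨[], .nil, by simp, by simp⟩
  obtain ⟨g, hgS, hg⟩ := exists_isSinkOf (C := C) hne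
  have hlt : S \ {g} < S := Set.sdiff_singleton_ssubset.2 hgS
  have hsub : S \ {g} ⊆ S := Set.sdiff_subset
  -- This program serves every case but the product of two non-constant arguments: it needs at most
  -- one more instruction, for `g`.
  obtain ⟨l, hl, hlen, hval⟩ := ih _ hlt (hS.diff_singleton hg)
  have hlen_le : l.length ≤ (S ∩ C.costGates).ncard :=
    hlen.trans (Set.ncard_le_ncard (Set.inter_subset_inter_left _ hsub))
  have hlen_lt : g ∈ C.costGates → l.length + 1 ≤ (S ∩ C.costGates).ncard := fun hcost => by
    refine Nat.lt_of_le_of_lt hlen (Set.ncard_lt_ncard ?_)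
    exact ⟨Set.inter_subset_inter_left _ hsub, fun h => (h ⟨hgS, hcost⟩).1.2 rfl⟩
  have harg : ∀ {o arg w}, C.node g = .op o arg w → ∀ p,
      IsScaledValue K l (C.gatePoly (arg p)) := fun {o arg w} hn p => by
    have ha : IsArrow C.node (arg p) g p := ⟨o, arg, w, hn, rfl⟩
    exact hval _ ⟨hS _ _ _ ha hgS, ne_of_isArrow ha⟩
      (hg.isReusableIn hS ha hsub fun h => h.2 rfl)
  have hext : ∀ l', l ⊆ l' → IsScaledValue K l' (C.gatePoly g) →
      ∀ h ∈ S, C.IsReusableIn S h → IsScaledValue K l' (C.gatePoly h) := by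
    intro l' hl' hg' h hh hr
    rcases eq_or_ne h g with rfl | hne
    · exact hg'
    · exact (hval h ⟨hh, hne⟩ (hr.mono hsub)).mono hl'
  by_cases hconst : C.IsConstGate g
  · obtain ⟨c, hc, hc'⟩ := hconst.gatePoly_eq_C hK
    exact ⟨l, hl, hlen_le, hext l (List.Subset.refl l)
      ⟨c, hc, 1, List.mem_cons_self, by rw [hc', mul_one]⟩⟩
  rcases hn : C.node g with c | x | ⟨o, arg, w⟩
  · exact absurd (.input c hn) hconst
  · refine ⟨_, .var x 1 ⟨g, hn⟩ List.mem_cons_self hl, hlen_lt (Or.inr ⟨x, hn⟩),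
      hext _ (List.subset_cons_self _ _) (.of_mem (List.mem_cons_of_mem _ ?_))⟩
    rw [gatePoly_eq, hn]
    simp
  have hw := fun p => hK (weight_mem_scalars hn p)
  cases o with
  | add =>
    obtain ⟨a, ha, y, hy, hay⟩ := harg hn 0
    obtain ⟨b, hb, z, hz, hbz⟩ := harg hn 1
    have hgreen : g ∈ C.greenGates :=
      ⟨⟨_, _, _, hn⟩, hconst, fun ⟨_, _, hm, _⟩ => by rw [hn] at hm; cases hm⟩
    refine ⟨_, .add _ _ y z (K.mul_mem (hw 0) ha) (K.mul_mem (hw 1) hb) hy hz hl,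
      hlen_lt (Or.inl hgreen),
      hext _ (List.subset_cons_self _ _) (.of_mem (List.mem_cons_of_mem _ ?_))⟩
    rw [gatePoly_eq, hn]
    simp [hay, hbz, mul_assoc]
  | mul =>
    by_cases hmul : ∃ p, C.IsConstGate (arg p)
    · obtain ⟨p, hp⟩ := hmul
      obtain ⟨c, hc, hc'⟩ := hp.gatePoly_eq_C hK
      obtain ⟨q, hq⟩ := exists_ne p
      refine ⟨l, hl, hlen_le, hext l (List.Subset.refl l) ?_⟩
      rw [gatePoly_of_mul hn hq.symm, hc', ← mul_assoc, ← map_mul]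
      exact (harg hn q).C_mul (K.mul_mem (K.mul_mem (hw p) (hw q)) hc)
    -- Both factors are available in `l`, but their product is not an instruction; `S` is split
    -- differently instead.
    clear hext harg hlen_lt hlen_le hval hlen hl l
    obtain ⟨p, hp⟩ := hC g arg w hn
    obtain ⟨q, hq⟩ := exists_ne p
    have hap : IsArrow C.node (arg p) g p := ⟨_, arg, w, hn, rfl⟩
    have haq : IsArrow C.node (arg q) g q := ⟨_, arg, w, hn, rfl⟩
    have hcl : C.IsClosedArrow (arg p) g p := ⟨hap, hp⟩
    have hgp : g ∉ C.sub (arg p) := not_mem_sub_of_isArrow hap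
    have hpS : C.sub (arg p) ⊆ S := hS.sub_subset (hS _ _ _ hap hgS)
    have hsub₂ : (S \ {g}) \ C.sub (arg p) ⊆ S := Set.sdiff_subset.trans hsub
    obtain ⟨l₁, hl₁, hlen₁, hval₁⟩ := ih (C.sub (arg p)) ⟨hpS, fun h => hgp (h hgS)⟩
      (isArgClosed_sub _)
    obtain ⟨l₂, hl₂, hlen₂, hval₂⟩ := ih _ (lt_of_le_of_lt Set.sdiff_subset hlt)
      (hS.diff_sub hg hcl)
    -- Were `arg q` in the sub-circuit of `arg p`, its arrow to `g` would be a second exit. This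
    -- also covers `arg p = arg q`.
    have hqmem : arg q ∈ (S \ {g}) \ C.sub (arg p) :=
      ⟨⟨hS _ _ _ haq hgS, ne_of_isArrow haq⟩, fun h => hq (hp _ _ _ haq h hgp).2⟩
    obtain ⟨a, ha, y, hy, hay⟩ := hval₂ _ hqmem
      (hg.isReusableIn hS haq hsub₂ fun h => h.1.2 rfl)
    obtain ⟨b, hb, z, hz, hbz⟩ := hval₁ _ (mem_sub_self _) (isReusableIn_sub_self _)
    -- The isolated sub-circuit is run from the value `y` of `arg q`. Its own values survive only
    -- multiplied by `y`, which is harmless: none of its gates is reusable in `S`.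
    refine ⟨_, hl₁.map_mul_append hl₂ hy, ?_, fun h hh hr => ?_⟩
    · rw [List.length_append, List.length_map]
      refine (Nat.add_le_add hlen₁ hlen₂).trans ?_
      rw [← Set.ncard_union_eq]
      · exact Set.ncard_le_ncard (Set.union_subset (Set.inter_subset_inter_left _ hpS)
          (Set.inter_subset_inter_left _ hsub₂))
      · exact Set.disjoint_left.2 fun _ h h' => h'.1.2 h.1
    · rcases eq_or_ne h g with rfl | hne
      · refine ⟨w p * w q * (b * a), K.mul_mem (K.mul_mem (hw p) (hw q)) (K.mul_mem hb ha), z * y,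
          mem_cons_map_mul_append hy hz, ?_⟩
        rw [gatePoly_of_mul hn hq.symm, hay, hbz]
        simp only [map_mul]
        ring
      · exact (hval₂ h ⟨⟨hh, hne⟩, hr g hgS _ p hcl⟩ (hr.mono hsub₂)).mono
          (List.subset_append_right _ _)

end WeightedCircuit

theorem mainTheorem2 {k σ G : Type*} [Field k] (hk : (2 : k) ≠ 0) [Finite G]
    (C : WeightedCircuit k σ G) (hC : C.IsWeaklySkew) :
    ∃ n : ℕ, 1 ≤ n ∧ n ≤ 2 * (C.greenSize + C.numVarInputs) + 1 ∧
      ∃ A : Matrix (Fin n) (Fin n) (MvPolynomial σ k),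
        A.IsSymm ∧
        (∀ i j, (∃ g x, C.node g = .var x ∧ A i j = MvPolynomial.X x) ∨
          (∃ c ∈ Subring.closure (insert (1 / 2 : k) C.scalars), A i j = MvPolynomial.C c)) ∧
        C.poly = A.det := by
  have hK := Subring.subset_closure (s := insert (1 / 2 : k) C.scalars)
  obtain ⟨l, hl, hlen, hval⟩ := hC.exists_isProgram ((Set.subset_insert _ _).trans hK) Set.univ
    fun _ _ _ _ _ => trivial
  obtain ⟨a, ha, y, hy, hpoly⟩ := hval C.output trivial
    (WeightedCircuit.isReusableIn_output _)
  obtain ⟨A, hA, hent, hdet⟩ := hl.exists_isSymm_det hk (hK (Set.mem_insert _ _)) ha hy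
  have hcost : l.length ≤ C.greenSize + C.numVarInputs := by
    rw [Set.univ_inter] at hlen
    exact hlen.trans (Set.ncard_union_le _ _)
  refine ⟨2 * l.length + 1, by omega, by omega, A, hA, fun i j => ?_, hpoly.trans hdet⟩
  exact (hent i j).imp_left fun ⟨x, ⟨g, hg⟩, hx⟩ => ⟨g, x, hg, hx⟩
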